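/- Let $\mathcal{E}_0,\mathcal{E}_1$ be two arbitrary quantum channels (completely positive trace-preserving maps) from a system of finite dimension $d\ge 1$ to a system of finite dimension $e$. **Adaptive discrimination.** An $n$-use adaptive protocol $\mathcal{P}_n$ starts with registers of arbitrary finite dimension in an arbitrary joint state $\rho_0$. In each of the $n$ rounds a $d$-dimensional system is picked from the registers and sent through the unknown channel, the $e$-dimensional output is merged with the rest of the registers, and an arbitrary trace-preserving quantum operation is applied to all the registers. Write $\rho_n(u)$ for the final state when the channel is $\mathcal{E}_u$, where $u\in\{0,1\}$ is equiprobable. The error probability $p(\mathcal{E}_0\neq\mathcal{E}_1|\mathcal{P}_n)$ is the minimum of $\frac12\mathrm{Tr}[Q_1\rho_n(0)]+\frac12\mathrm{Tr}[Q_0\rho_n(1)]$ over all two-outcome POVMs $\{Q_0,Q_1\}$, and $p_n(\mathcal{E}_0\neq\mathcal{E}_1):=\inf_{\mathcal{P}_n}p(\mathcal{E}_0\neq\mathcal{E}_1|\mathcal{P}_n)$. **Port-based teleportation.** Let $|\Phi\rangle=d^{-1/2}\sum_{k}|k\rangle|k\rangle$. For $M\ge 1$ let $\mathbf{A}=A_1\dots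 A_M$, $\mathbf{B}=B_1\dots B_M$ and $C$ be $d$-dimensional qudits, $\sigma^i=d^{-(M-1)}|\Phi\rangle\langle\Phi|_{A_iC}\otimes\mathbb{I}_{\mathbf{A}\setminus A_i}$, $\rho=\sum_i\sigma^i$, and $$\Pi^i_{C\mathbf{A}}=\rho^{-1/2}\sigma^i\rho^{-1/2}+M^{-1}\big(\mathbb{I}-\rho^{-1/2}\rho\,\rho^{-1/2}\big),$$ with $\rho^{-1/2}$ taken on the support of $\rho$. The $M$-port teleportation channel is $$\Gamma_M(\rho_C)=\sum_{i=1}^M\mathrm{Tr}_{\mathbf{A}\bar{B}_iC}\big[\Pi^i_{C\mathbf{A}}(\rho_C\otimes|\Phi\rangle\langle\Phi|_{\mathbf{AB}}^{\otimes M})\big],$$ where $\mathrm{Tr}_{\bar B_i}$ traces out all the ports but $B_i$. Its simulation error is $\delta_M:=\|\mathcal{I}-\Gamma_M\|_\diamond$, where $\|\mathcal{E}-\mathcal{F}\|_\diamond:=\sup_{\rho_{ra}}\|(\mathcal{I}_r\otimes\mathcal{E})(\rho_{ra})-(\mathcal{I}_r\otimes\mathcal{F})(\rho_{ra})\|$ is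 a supremum over all finite-dimensional reference systems $r$ and all joint states, and $\|X\|=\mathrm{Tr}\sqrt{X^\dagger X}$. **Theorem.** For all $n\ge 0$ and every number of ports $M\ge 1$, $$p_n(\mathcal{E}_0\neq\mathcal{E}_1)\;\ge\;\frac{1-n\,\delta_M-D\big(\rho_{\mathcal{E}_0}^{\otimes nM},\rho_{\mathcal{E}_1}^{\otimes nM}\big)}{2},$$ where $\rho_{\mathcal{E}_u}=(\mathcal{I}\otimes\mathcal{E}_u)(|\Phi\rangle\langle\Phi|)$ are the Choi matrices and $D(\rho,\sigma)=\|\rho-\sigma\|/2$ is the trace distance. In particular, $M$ may be chosen to maximize the right-hand side. -/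

import Mathlib

open scoped Kronecker ComplexOrder

noncomputable section

namespace QCD

/-! Finite-dimensional quantum systems: a system with orthonormal basis indexed by `α` has its
operators represented by matrices `Matrix α α ℂ`; a composite system is indexed by a product. -/

/-- A quantum state (density matrix). -/
def IsState {α : Type*} [Fintype α] (ρ : Matrix α α ℂ) : Prop :=
  ρ.PosSemidef ∧ ρ.trace = 1

/-- The trace norm `‖X‖ = Tr √(X† X)`, i.e. the sum of the singular values of `X`. -/
def traceNorm {α : Type*} [Fintype α] [DecidableEq α] (X : Matrix α α ℂ) : ℝ :=
  ∑ i, √((Matrix.isHermitian_conjTranspose_mul_self X).eigenvalues i)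

/-- The trace distance `D(ρ, σ) = ‖ρ - σ‖ / 2`. -/
def traceDist {α : Type*} [Fintype α] [DecidableEq α] (ρ σ : Matrix α α ℂ) : ℝ :=
  traceNorm (ρ - σ) / 2

/-- `(I ⊗ E)(X)`, the map `E` applied to the second factor of a composite system whose first
factor is indexed by `γ`. -/
def idTensor {α β γ : Type*} (E : Matrix α α ℂ →ₗ[ℂ] Matrix β β ℂ)
    (X : Matrix (γ × α) (γ × α) ℂ) : Matrix (γ × β) (γ × β) ℂ :=
  Matrix.of fun x y => E (X.submatrix (fun i => (x.1, i)) (fun j => (y.1, j))) x.2 y.2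

/-- Quantum channels: completely positive trace-preserving linear maps. -/
def IsChannel {α β : Type*} [Fintype α] [Fintype β]
    (E : Matrix α α ℂ →ₗ[ℂ] Matrix β β ℂ) : Prop :=
  (∀ (r : ℕ) (X : Matrix (Fin r × α) (Fin r × α) ℂ), X.PosSemidef → (idTensor E X).PosSemidef) ∧
    ∀ X : Matrix α α ℂ, (E X).trace = X.trace

/-- The diamond distance `‖E - F‖_⋄`: the supremum, over all finite-dimensional reference systems
and all joint input states `ρ`, of `‖(I ⊗ E)(ρ) - (I ⊗ F)(ρ)‖`. -/
def diamondDist {α β : Type*} [Fintype α] [Fintype β] [DecidableEq β]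
    (E F : Matrix α α ℂ →ₗ[ℂ] Matrix β β ℂ) : ℝ :=
  sSup {x : ℝ | ∃ (r : ℕ) (ρ : Matrix (Fin r × α) (Fin r × α) ℂ), IsState ρ ∧
    x = traceNorm (idTensor E ρ - idTensor F ρ)}

/-- The `N`-fold tensor power of a matrix. -/
def tensorPow {α : Type*} (X : Matrix α α ℂ) (N : ℕ) : Matrix (Fin N → α) (Fin N → α) ℂ :=
  Matrix.of fun f g => ∏ i, X (f i) (g i)

/-- The maximally entangled vector `|Φ⟩ = d^{-1/2} ∑ₖ |k⟩|k⟩`. -/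
def maxEntVec (d : ℕ) : Fin d × Fin d → ℂ :=
  fun x => if x.1 = x.2 then (((√(d : ℝ))⁻¹ : ℝ) : ℂ) else 0

/-- The maximally entangled state `|Φ⟩⟨Φ|`. -/
def maxEnt (d : ℕ) : Matrix (Fin d × Fin d) (Fin d × Fin d) ℂ :=
  Matrix.vecMulVec (maxEntVec d) (star (maxEntVec d))

/-- The (normalized) Choi matrix `ρ_E = (I ⊗ E)(|Φ⟩⟨Φ|)`. -/
def choi {d : ℕ} {β : Type*} (E : Matrix (Fin d) (Fin d) ℂ →ₗ[ℂ] Matrix β β ℂ) :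
    Matrix (Fin d × β) (Fin d × β) ℂ :=
  idTensor E (maxEnt d)

/-! ### Port-based teleportation

Systems: the input qudit `C` (`Fin d`), the `M` qudits `A` of the sender and the `M` qudits
(ports) `B` of the receiver (each `Fin M → Fin d`). -/

/-- `σⁱ = d^{-(M-1)} |Φ⟩⟨Φ|_{A_i C} ⊗ 𝟙` on `C A`, the identity acting on the `A_j` with `j ≠ i`. -/
def pbtSigma (d M : ℕ) (i : Fin M) :
    Matrix (Fin d × (Fin M → Fin d)) (Fin d × (Fin M → Fin d)) ℂ :=
  Matrix.of fun x y =>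
    ((d : ℂ) ^ (M - 1))⁻¹ * (maxEnt d (x.2 i, x.1) (y.2 i, y.1) *
      if ∀ j, j ≠ i → x.2 j = y.2 j then 1 else 0)

/-- `ρ = ∑ᵢ σⁱ`. -/
def pbtRho (d M : ℕ) : Matrix (Fin d × (Fin M → Fin d)) (Fin d × (Fin M → Fin d)) ℂ :=
  ∑ i, pbtSigma d M i

/-- `ρ^{-1/2}`, the inverse square root on the support of `ρ` (and `0` on its kernel). -/
def pbtRhoInvSqrt (d M : ℕ) : Matrix (Fin d × (Fin M → Fin d)) (Fin d × (Fin M → Fin d)) ℂ :=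
  cfc (fun x : ℝ => (√x)⁻¹) (pbtRho d M)

/-- The square-root measurement of the sender,
`Πⁱ = ρ^{-1/2} σⁱ ρ^{-1/2} + M⁻¹ (𝟙 - ρ^{-1/2} ρ ρ^{-1/2})`. -/
def pbtPOVM (d M : ℕ) (i : Fin M) :
    Matrix (Fin d × (Fin M → Fin d)) (Fin d × (Fin M → Fin d)) ℂ :=
  pbtRhoInvSqrt d M * pbtSigma d M i * pbtRhoInvSqrt d M +
    ((M : ℂ)⁻¹) • (1 - pbtRhoInvSqrt d M * pbtRho d M * pbtRhoInvSqrt d M)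

/-- The resource state `|Φ⟩⟨Φ|^{⊗M}` of the pairs `(A_i, B_i)`, as an operator on `A B`. -/
def pbtResource (d M : ℕ) :
    Matrix ((Fin M → Fin d) × (Fin M → Fin d)) ((Fin M → Fin d) × (Fin M → Fin d)) ℂ :=
  (tensorPow (maxEnt d) M).submatrix (fun x i => (x.1 i, x.2 i)) (fun x i => (x.1 i, x.2 i))

/-- The state `ρ_C ⊗ |Φ⟩⟨Φ|_{AB}^{⊗M}`, as an operator on `(C A) B`. -/
def pbtJoint (d M : ℕ) (ρ : Matrix (Fin d) (Fin d) ℂ) :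
    Matrix ((Fin d × (Fin M → Fin d)) × (Fin M → Fin d))
      ((Fin d × (Fin M → Fin d)) × (Fin M → Fin d)) ℂ :=
  (ρ ⊗ₖ pbtResource d M).submatrix (fun x => (x.1.1, (x.1.2, x.2))) (fun x => (x.1.1, (x.1.2, x.2)))

/-- The partial trace over a system `S` and over all the ports `B` except `B_i`. -/
def keepPort {S : Type*} [Fintype S] {d M : ℕ} (i : Fin M)
    (X : Matrix (S × (Fin M → Fin d)) (S × (Fin M → Fin d)) ℂ) : Matrix (Fin d) (Fin d) ℂ :=
  Matrix.of fun k l => ∑ s, ∑ b : Fin M → Fin d,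
    if b i = k then X (s, b) (s, Function.update b i l) else 0

/-- The channel of standard port-based teleportation with `M` ports,
`Γ_M(ρ) = ∑ᵢ Tr_{C A B̄_i} [Πⁱ (ρ ⊗ |Φ⟩⟨Φ|^{⊗M})]`. -/
def pbtChannel (d M : ℕ) : Matrix (Fin d) (Fin d) ℂ →ₗ[ℂ] Matrix (Fin d) (Fin d) ℂ where
  toFun ρ := ∑ i, keepPort i
    ((pbtPOVM d M i ⊗ₖ (1 : Matrix (Fin M → Fin d) (Fin M → Fin d) ℂ)) * pbtJoint d M ρ)
  map_add' ρ σ := by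
    have h : pbtJoint d M (ρ + σ) = pbtJoint d M ρ + pbtJoint d M σ := by
      ext x y; simp [pbtJoint, add_mul]
    rw [h, ← Finset.sum_add_distrib]
    refine Finset.sum_congr rfl fun i _ => ?_
    ext k l
    simp only [keepPort, Matrix.mul_add, Matrix.of_apply, Matrix.add_apply,
      ← Finset.sum_add_distrib]
    refine Finset.sum_congr rfl fun s _ => Finset.sum_congr rfl fun b _ => ?_
    split_ifs <;> simp
  map_smul' c ρ := by
    have h : pbtJoint d M (c • ρ) = c • pbtJoint d M ρ := by
      ext x y; simp [pbtJoint, mul_assoc]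
    rw [h, Finset.smul_sum]
    refine Finset.sum_congr rfl fun i _ => ?_
    ext k l
    simp only [keepPort, Matrix.mul_smul, Matrix.of_apply, Matrix.smul_apply, RingHom.id_apply,
      Finset.smul_sum]
    refine Finset.sum_congr rfl fun s _ => Finset.sum_congr rfl fun b _ => ?_
    split_ifs <;> simp

/-- The simulation error `δ_M = ‖I - Γ_M‖_⋄`. -/
def simError (d M : ℕ) : ℝ :=
  diamondDist LinearMap.id (pbtChannel d M)

/-! ### Adaptive discrimination -/

/-- An adaptive protocol with `n` uses of a channel from a `d`-dimensional to an `e`-dimensional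
system. Before use `k` the registers, of arbitrary finite dimension `regDim k`, are in some state
(initially an arbitrary state `init`); a `d`-dimensional system is picked from them (`pick`) and
sent through the channel, the `e`-dimensional output is merged with the rest of the registers, and
an arbitrary quantum operation `op k` is applied to all the registers. -/
structure AdaptiveProtocol (d e n : ℕ) where
  regDim : Fin (n + 1) → ℕ
  restDim : Fin n → ℕ
  init : Matrix (Fin (regDim 0)) (Fin (regDim 0)) ℂ
  init_isState : IsState init
  pick : ∀ k : Fin n, Fin (regDim k.castSucc) ≃ Fin (restDim k) × Fin d
  op : ∀ k : Fin n, Matrix (Fin (restDim k) × Fin e) (Fin (restDim k) × Fin e) ℂ →ₗ[ℂ]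
    Matrix (Fin (regDim k.succ)) (Fin (regDim k.succ)) ℂ
  op_isChannel : ∀ k, IsChannel (op k)

/-- The state of the registers after `k` uses of the channel `E` (and the operations that
follow each of them). -/
def AdaptiveProtocol.state {d e n : ℕ} (P : AdaptiveProtocol d e n)
    (E : Matrix (Fin d) (Fin d) ℂ →ₗ[ℂ] Matrix (Fin e) (Fin e) ℂ) (k : Fin (n + 1)) :
    Matrix (Fin (P.regDim k)) (Fin (P.regDim k)) ℂ :=
  Fin.induction (motive := fun k => Matrix (Fin (P.regDim k)) (Fin (P.regDim k)) ℂ) P.init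
    (fun k ρ => P.op k (idTensor E (ρ.submatrix (P.pick k).symm (P.pick k).symm))) k

/-- The output state `ρ_n` of the protocol. -/
def AdaptiveProtocol.output {d e n : ℕ} (P : AdaptiveProtocol d e n)
    (E : Matrix (Fin d) (Fin d) ℂ →ₗ[ℂ] Matrix (Fin e) (Fin e) ℂ) :
    Matrix (Fin (P.regDim (Fin.last n))) (Fin (P.regDim (Fin.last n))) ℂ :=
  P.state E (Fin.last n)

/-- Two-outcome positive-operator valued measures. -/
structure BinaryPOVM (α : Type*) [Fintype α] [DecidableEq α] where
  elt : Fin 2 → Matrix α α ℂ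
  posSemidef : ∀ u, (elt u).PosSemidef
  sum_eq_one : ∑ u, elt u = 1

/-- The minimum probability, over all measurements of the output of the protocol `P`, of guessing
incorrectly which of the two equiprobable channels `E 0`, `E 1` was used. -/
def protocolError {d e n : ℕ}
    (E : Fin 2 → (Matrix (Fin d) (Fin d) ℂ →ₗ[ℂ] Matrix (Fin e) (Fin e) ℂ))
    (P : AdaptiveProtocol d e n) : ℝ :=
  ⨅ Q : BinaryPOVM (Fin (P.regDim (Fin.last n))),
    (1 / 2 : ℝ) * (Q.elt 1 * P.output (E 0)).trace.re +
      (1 / 2 : ℝ) * (Q.elt 0 * P.output (E 1)).trace.re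

/-- The minimum error probability `p_n` of the adaptive discrimination of `E 0` and `E 1` with
`n` uses: the infimum over all adaptive protocols. -/
def minErrorProb {d e : ℕ}
    (E : Fin 2 → (Matrix (Fin d) (Fin d) ℂ →ₗ[ℂ] Matrix (Fin e) (Fin e) ℂ)) (n : ℕ) : ℝ :=
  ⨅ P : AdaptiveProtocol d e n, protocolError E P

end QCD

end

noncomputable section

namespace QCD

/-! ### Trace norm and positive functionals -/

/-! Fix a protocol and a measurement, and put q(u) = Tr[Q₀ ρₙ(u)]. The error is (1 - q(0) + q(1)) /
2, so it suffices to bound q(0) - q(1) by n δ_M plus the trace distance of the Choi resources.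

Replace every use of the unknown channel `E` by `E ∘ Γ_M`. One replacement moves an outcome
probability by at most δ_M / 2, so each q(u) moves by at most n δ_M / 2 (`abs_re_state_sub_le`), and
the two hypotheses together cost n δ_M.

The channel `E ∘ Γ_M` is exactly port-based teleportation with the resource |Φ⟩⟨Φ|^{⊗M} replaced by
M Choi states of `E` (`pbtSim_choi`): `E` on the kept port commutes with the sender's measurement,
and on a discarded port it is invisible because it preserves the trace. Hence the modified protocol
is a channel independent of `E`, applied to nM Choi states (`exists_simulation`), and its outcome
probabilities differ by at most the trace distance of these resources.

All estimates are made on effects, in the Heisenberg picture. The pull-back of an effect by a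
channel is an effect (`IsEffect.comp`), so contractivity of the trace norm is never needed; the only
norm inequality is |φ(X)| ≤ ‖X‖ / 2 for traceless Hermitian X (`IsEffect.abs_re_le`). -/

theorem traceNorm_eq_sum_abs_eigenvalues {α : Type*} [Fintype α] [DecidableEq α]
    {X : Matrix α α ℂ} (hX : X.IsHermitian) : traceNorm X = ∑ i, |hX.eigenvalues i| := by
  have hsq : X.conjTranspose * X = cfc (fun x : ℝ => x ^ 2) X := by
    rw [hX.eq, cfc_pow_id (R := ℝ) X 2 hX.isSelfAdjoint, sq]
  have hprod : ∀ f : α → ℂ, (∏ i, (Polynomial.X - Polynomial.C (f i))).roots =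
      Multiset.map f Finset.univ.val := fun f => by
    rw [Polynomial.roots_prod]
    · simp
    · simp [Finset.prod_ne_zero_iff, Polynomial.X_sub_C_ne_zero]
  -- The eigenvalues of X†X and the squares of those of X need not be indexed in the same order, so
  -- they are compared as multisets of roots of one characteristic polynomial.
  have hroots := (Matrix.isHermitian_conjTranspose_mul_self X).roots_charpoly_eq_eigenvalues
  have hroots' : (X.conjTranspose * X).charpoly.roots =
      Multiset.map (fun i => ((hX.eigenvalues i ^ 2 : ℝ) : ℂ)) Finset.univ.val := by
    rw [hsq, hX.charpoly_cfc_eq]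
    exact hprod _
  have h := congrArg (fun s : Multiset ℂ => (s.map fun z => √z.re).sum) (hroots.symm.trans hroots')
  simp only [Multiset.map_map, Function.comp_def] at h
  change ∑ i, √((((Matrix.isHermitian_conjTranspose_mul_self X).eigenvalues i : ℝ) : ℂ).re) =
    ∑ i, √((((hX.eigenvalues i ^ 2 : ℝ)) : ℂ).re) at h
  simpa [traceNorm, Complex.ofReal_re, Real.sqrt_sq_eq_abs, -Complex.ofReal_pow] using h

/-- Positive functionals dominated by the trace. -/
def IsEffect {α : Type*} [Fintype α] (φ : Matrix α α ℂ →ₗ[ℂ] ℂ) : Prop :=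
  ∀ X : Matrix α α ℂ, X.PosSemidef → 0 ≤ φ X ∧ φ X ≤ X.trace

/-- The projection on the `i`-th eigenvector of a Hermitian matrix. -/
def eigenProj {α : Type*} [Fintype α] [DecidableEq α] {X : Matrix α α ℂ} (hX : X.IsHermitian)
    (i : α) : Matrix α α ℂ :=
  Matrix.vecMulVec (hX.eigenvectorBasis i) (star ⇑(hX.eigenvectorBasis i))

section eigenProj

variable {α : Type*} [Fintype α] [DecidableEq α] {X : Matrix α α ℂ} (hX : X.IsHermitian)

theorem posSemidef_eigenProj (i : α) : (eigenProj hX i).PosSemidef :=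
  Matrix.posSemidef_vecMulVec_self_star _

theorem trace_eigenProj (i : α) : (eigenProj hX i).trace = 1 := by
  have h := hX.eigenvectorBasis.orthonormal.1 i
  have h2 : inner ℂ (hX.eigenvectorBasis i) (hX.eigenvectorBasis i) = (1 : ℂ) := by
    rw [inner_self_eq_norm_sq_to_K, h]; simp
  rw [eigenProj, Matrix.trace_vecMulVec, ← h2]
  rfl

theorem sum_eigenvalues_smul_eigenProj :
    ∑ i, (hX.eigenvalues i : ℂ) • eigenProj hX i = X := by
  conv_rhs => rw [hX.spectral_theorem]
  ext a b
  simp [Matrix.sum_apply, eigenProj, Matrix.vecMulVec_apply, Unitary.conjStarAlgAut_apply,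
    Matrix.mul_apply, Matrix.diagonal_apply, Matrix.IsHermitian.eigenvectorUnitary_apply]
  refine Finset.sum_congr rfl fun i _ => ?_
  ring

theorem sum_eigenProj : ∑ i, eigenProj hX i = 1 := by
  have h := Unitary.coe_mul_star_self hX.eigenvectorUnitary
  rw [← h]
  ext a b
  simp [Matrix.sum_apply, eigenProj, Matrix.vecMulVec_apply,
    Matrix.mul_apply, Matrix.IsHermitian.eigenvectorUnitary_apply]

end eigenProj

/-- In an eigenbasis, φ(X) = ∑ λᵢ qᵢ with qᵢ ∈ [0, 1]. Since ∑ λᵢ = 0, each qᵢ may be replaced by qᵢ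
- 1/2, of modulus at most 1/2; this centring gives the factor 1/2. -/
theorem IsEffect.abs_re_le {α : Type*} [Fintype α] [DecidableEq α] {φ : Matrix α α ℂ →ₗ[ℂ] ℂ}
    (hφ : IsEffect φ) {X : Matrix α α ℂ} (hX : X.IsHermitian) (htr : X.trace = 0) :
    |(φ X).re| ≤ traceNorm X / 2 := by
  have hq : ∀ i, |(φ (eigenProj hX i)).re - 1 / 2| ≤ 1 / 2 := fun i => by
    have h := hφ _ (posSemidef_eigenProj hX i)
    rw [trace_eigenProj] at h
    have h0 := (Complex.le_def.1 h.1).1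
    have h1 := (Complex.le_def.1 h.2).1
    simp only [Complex.zero_re, Complex.one_re] at h0 h1
    rw [abs_le]; constructor <;> linarith
  have hsum : ∑ i, hX.eigenvalues i = 0 := by
    have h := hX.trace_eq_sum_eigenvalues
    rw [htr] at h
    rw [← Complex.ofReal_inj, Complex.ofReal_sum]
    exact h.symm
  have hval : (φ X).re = ∑ i, hX.eigenvalues i * ((φ (eigenProj hX i)).re - 1 / 2) := by
    conv_lhs => rw [← sum_eigenvalues_smul_eigenProj hX]
    simp [mul_sub, Finset.sum_sub_distrib, ← Finset.sum_mul, hsum]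
  rw [hval, traceNorm_eq_sum_abs_eigenvalues hX, Finset.sum_div]
  refine (Finset.abs_sum_le_sum_abs _ _).trans (Finset.sum_le_sum fun i _ => ?_)
  rw [abs_mul]
  nlinarith [hq i, abs_nonneg (hX.eigenvalues i)]

theorem trace_mul_nonneg {α : Type*} [Fintype α] {P X : Matrix α α ℂ}
    (hP : P.PosSemidef) (hX : X.PosSemidef) : 0 ≤ (P * X).trace := by
  classical
  open scoped MatrixOrder in
  obtain ⟨B, rfl⟩ := CStarAlgebra.nonneg_iff_eq_star_mul_self.mp hP.nonneg
  rw [Matrix.star_eq_conjTranspose, Matrix.mul_assoc, Matrix.trace_mul_comm]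
  exact (hX.mul_mul_conjTranspose_same B).trace_nonneg

/-- Each eigenvalue of ρ - σ is the difference of the probabilities of one outcome when ρ and σ are
measured in its eigenbasis, hence bounded by their sum. The bound makes the set defining the diamond
distance bounded above, without which the real `sSup` would not be a supremum. -/
theorem traceNorm_sub_le {α : Type*} [Fintype α] [DecidableEq α] {ρ σ : Matrix α α ℂ}
    (hρ : IsState ρ) (hσ : IsState σ) : traceNorm (ρ - σ) ≤ 2 := by
  have hX : (ρ - σ).IsHermitian := hρ.1.isHermitian.sub hσ.1.isHermitian
  have hev : ∀ i, ((hX.eigenvalues i : ℝ) : ℂ) =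
      (eigenProj hX i * ρ).trace - (eigenProj hX i * σ).trace := fun i => by
    rw [← Matrix.trace_sub, ← Matrix.mul_sub, Matrix.trace_mul_comm, eigenProj,
      Matrix.mul_vecMulVec, hX.mulVec_eigenvectorBasis, Matrix.smul_vecMulVec,
      Matrix.trace_smul]
    have h := trace_eigenProj hX i
    rw [eigenProj] at h
    rw [h]
    simp
  have hsum : ∀ τ : Matrix α α ℂ, IsState τ → ∑ i, (eigenProj hX i * τ).trace.re = 1 := by
    intro τ hτ
    rw [← Complex.re_sum, ← Matrix.trace_sum, ← Finset.sum_mul, sum_eigenProj, one_mul, hτ.2]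
    simp
  rw [traceNorm_eq_sum_abs_eigenvalues hX]
  calc ∑ i, |hX.eigenvalues i|
      ≤ ∑ i, ((eigenProj hX i * ρ).trace.re + (eigenProj hX i * σ).trace.re) := by
        refine Finset.sum_le_sum fun i _ => ?_
        have h := congrArg Complex.re (hev i)
        rw [Complex.ofReal_re, Complex.sub_re] at h
        have h0 := (Complex.le_def.1 (trace_mul_nonneg (posSemidef_eigenProj hX i) hρ.1)).1
        have h1 := (Complex.le_def.1 (trace_mul_nonneg (posSemidef_eigenProj hX i) hσ.1)).1
        rw [Complex.zero_re] at h0 h1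
        rw [h, abs_le]; constructor <;> linarith
    _ = 2 := by rw [Finset.sum_add_distrib, hsum ρ hρ, hsum σ hσ]; norm_num

/-! ### Completely positive maps and channels -/

section CP

variable {α β δ γ : Type*}

/-- Completely positive maps. -/
def IsCP [Fintype α] [Fintype β] (E : Matrix α α ℂ →ₗ[ℂ] Matrix β β ℂ) : Prop :=
  ∀ (r : ℕ) (X : Matrix (Fin r × α) (Fin r × α) ℂ), X.PosSemidef → (idTensor E X).PosSemidef

/-- `I ⊗ E` as a linear map. -/
def idTensorMap (γ : Type*) (E : Matrix α α ℂ →ₗ[ℂ] Matrix β β ℂ) :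
    Matrix (γ × α) (γ × α) ℂ →ₗ[ℂ] Matrix (γ × β) (γ × β) ℂ where
  toFun := idTensor E
  map_add' X Y := by
    ext x y
    simp only [idTensor, Matrix.of_apply, Matrix.add_apply, Matrix.submatrix_add]
    exact congrFun (congrFun (map_add E _ _) x.2) y.2
  map_smul' c X := by
    ext x y
    simp only [idTensor, Matrix.of_apply, Matrix.smul_apply, RingHom.id_apply, Matrix.submatrix_smul]
    exact congrFun (congrFun (map_smul E _ _) x.2) y.2

/-- Relabelling of the basis of a system. -/
def relabel (f : β → α) : Matrix α α ℂ →ₗ[ℂ] Matrix β β ℂ where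
  toFun X := X.submatrix f f
  map_add' _ _ := rfl
  map_smul' _ _ := rfl

/-- Appending a system in the fixed state `τ`. -/
def attach (τ : Matrix δ δ ℂ) : Matrix α α ℂ →ₗ[ℂ] Matrix (α × δ) (α × δ) ℂ where
  toFun X := X ⊗ₖ τ
  map_add' X Y := Matrix.add_kronecker X Y τ
  map_smul' c X := Matrix.smul_kronecker c X τ

variable [Fintype α] [Fintype β] [Fintype δ] [Fintype γ]

/-- Complete positivity is defined with references `Fin r`; a numbering of γ carries it over to any
finite reference. -/
theorem IsCP.posSemidef {E : Matrix α α ℂ →ₗ[ℂ] Matrix β β ℂ} (hE : IsCP E)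
    {X : Matrix (γ × α) (γ × α) ℂ} (hX : X.PosSemidef) : (idTensor E X).PosSemidef := by
  let e := Fintype.equivFin γ
  have h := (hE _ (X.submatrix (Prod.map e.symm id) (Prod.map e.symm id))
    (hX.submatrix _)).submatrix (Prod.map e id)
  convert h using 1
  ext x y
  simp [idTensor, Function.comp_def]

theorem IsCP.map_posSemidef {E : Matrix α α ℂ →ₗ[ℂ] Matrix β β ℂ} (hE : IsCP E)
    {X : Matrix α α ℂ} (hX : X.PosSemidef) : (E X).PosSemidef :=
  (hE.posSemidef (γ := Unit) (hX.submatrix Prod.snd)).submatrix fun b => ((), b)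

theorem IsCP.comp {F : Matrix β β ℂ →ₗ[ℂ] Matrix δ δ ℂ} {E : Matrix α α ℂ →ₗ[ℂ] Matrix β β ℂ}
    (hF : IsCP F) (hE : IsCP E) : IsCP (F ∘ₗ E) :=
  fun r X hX => hF r _ (hE r X hX)

theorem IsCP.idTensorMap {E : Matrix α α ℂ →ₗ[ℂ] Matrix β β ℂ} (hE : IsCP E) :
    IsCP (idTensorMap γ E) := fun _ _ hX =>
  (hE.posSemidef (hX.submatrix (Equiv.prodAssoc _ _ _))).submatrix (Equiv.prodAssoc _ _ _).symm

theorem isCP_relabel (f : β → α) : IsCP (relabel f) := fun _ _ hX =>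
  hX.submatrix (Prod.map id f)

theorem isCP_attach {τ : Matrix δ δ ℂ} (hτ : τ.PosSemidef) :
    IsCP (attach (α := α) τ) := fun _ _ hX =>
  (hX.kronecker hτ).submatrix (Equiv.prodAssoc _ _ _).symm

theorem IsCP.sum {ι : Type*} {s : Finset ι} {E : ι → Matrix α α ℂ →ₗ[ℂ] Matrix β β ℂ}
    (hE : ∀ i ∈ s, IsCP (E i)) : IsCP (∑ i ∈ s, E i) := fun r X hX => by
  have h := Matrix.posSemidef_sum s fun i hi => hE i hi r X hX
  convert h using 1
  ext x y
  simp [idTensor, Matrix.sum_apply]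

/-- Summing all blocks is compression by the all-ones row on γ tensored with the identity on α. -/
theorem posSemidef_sum_blocks {H : Matrix (γ × α) (γ × α) ℂ} (hH : H.PosSemidef) :
    (Matrix.of fun a b => ∑ s, ∑ t, H (s, a) (t, b)).PosSemidef := by
  classical
  convert hH.mul_mul_conjTranspose_same (Matrix.of fun a (x : γ × α) => if a = x.2 then 1 else 0)
    using 1
  ext a b
  simp [Matrix.mul_apply, Fintype.sum_prod_type]
  rw [Finset.sum_comm]

namespace IsChannel

theorem isCP {E : Matrix α α ℂ →ₗ[ℂ] Matrix β β ℂ} (hE : IsChannel E) : IsCP E := hE.1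

theorem comp {F : Matrix β β ℂ →ₗ[ℂ] Matrix δ δ ℂ} {E : Matrix α α ℂ →ₗ[ℂ] Matrix β β ℂ}
    (hF : IsChannel F) (hE : IsChannel E) : IsChannel (F ∘ₗ E) :=
  ⟨hF.isCP.comp hE.isCP, fun X => (hF.2 _).trans (hE.2 X)⟩

theorem idTensorMap {E : Matrix α α ℂ →ₗ[ℂ] Matrix β β ℂ} (hE : IsChannel E) :
    IsChannel (idTensorMap γ E) :=
  ⟨hE.isCP.idTensorMap, fun X => by
    simp only [Matrix.trace, Matrix.diag, Fintype.sum_prod_type]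
    exact Finset.sum_congr rfl fun x _ => hE.2 (X.submatrix (fun i => (x, i)) fun j => (x, j))⟩

theorem map_isState {E : Matrix α α ℂ →ₗ[ℂ] Matrix β β ℂ} (hE : IsChannel E)
    {ρ : Matrix α α ℂ} (hρ : IsState ρ) : IsState (E ρ) :=
  ⟨hE.isCP.map_posSemidef hρ.1, (hE.2 ρ).trans hρ.2⟩

end IsChannel

theorem isChannel_relabel (e : β ≃ α) : IsChannel (relabel e) :=
  ⟨isCP_relabel e, fun X => Equiv.sum_comp e fun a => X a a⟩

theorem isChannel_attach {τ : Matrix δ δ ℂ} (hτ : IsState τ) :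
    IsChannel (attach (α := α) τ) :=
  ⟨isCP_attach hτ.1, fun X => by
    change (X ⊗ₖ τ).trace = _
    rw [Matrix.trace_kronecker, hτ.2, mul_one]⟩

theorem isChannel_id : IsChannel (LinearMap.id : Matrix α α ℂ →ₗ[ℂ] Matrix α α ℂ) :=
  ⟨fun _ _ hX => hX, fun _ => rfl⟩

/-- Discarding the system and preparing the state `τ`. -/
theorem isChannel_trace_smul {τ : Matrix δ δ ℂ} (hτ : IsState τ) :
    IsChannel ((Matrix.traceLinearMap α ℂ ℂ).smulRight τ) := by
  refine ⟨fun r X hX => ?_, fun X => by simp [hτ.2]⟩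
  have h := (Matrix.posSemidef_sum Finset.univ fun (a : α) _ =>
    hX.submatrix fun x : Fin r => (x, a)).kronecker hτ.1
  refine Eq.subst (motive := Matrix.PosSemidef) ?_ h
  ext x y
  simp [idTensor, Matrix.trace, Matrix.sum_apply]

theorem IsEffect.comp {φ : Matrix β β ℂ →ₗ[ℂ] ℂ} (hφ : IsEffect φ)
    {E : Matrix α α ℂ →ₗ[ℂ] Matrix β β ℂ} (hE : IsChannel E) : IsEffect (φ ∘ₗ E) := fun X hX => by
  have h := hφ _ (hE.isCP.map_posSemidef hX)
  rwa [hE.2] at h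

end CP

/-! ### The square-root measurement -/

theorem posSemidef_maxEnt (d : ℕ) : (maxEnt d).PosSemidef :=
  Matrix.posSemidef_vecMulVec_self_star _

theorem trace_maxEnt {d : ℕ} (hd : 0 < d) : (maxEnt d).trace = 1 := by
  have h : ((√(d : ℝ) : ℝ) : ℂ) * ((√(d : ℝ) : ℝ) : ℂ) = d := by
    rw [← Complex.ofReal_mul, Real.mul_self_sqrt (Nat.cast_nonneg d), Complex.ofReal_natCast]
  have hd' : (d : ℂ) ≠ 0 := Nat.cast_ne_zero.2 hd.ne'
  simp [Matrix.trace, maxEnt, Matrix.vecMulVec_apply, maxEntVec, Fintype.sum_prod_type,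
    ← mul_inv, h, hd']

theorem posSemidef_pbtSigma (d M : ℕ) (i : Fin M) : (pbtSigma d M i).PosSemidef := by
  -- Up to a nonnegative scalar, σⁱ is |Φ⟩⟨Φ| ⊗ 𝟙 with the second factor on the A_j, j ≠ i,
  -- reindexed.
  have h := ((posSemidef_maxEnt d).kronecker
    (Matrix.PosSemidef.one (n := {j : Fin M // j ≠ i} → Fin d) (R := ℂ))).submatrix
      fun x : Fin d × (Fin M → Fin d) => ((x.2 i, x.1), fun j => x.2 j.1)
  have hc : (0 : ℂ) ≤ ((d : ℂ) ^ (M - 1))⁻¹ := by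
    have : ((d : ℂ) ^ (M - 1))⁻¹ = (((d : ℝ) ^ (M - 1))⁻¹ : ℝ) := by push_cast; rfl
    rw [this]
    exact Complex.zero_le_real.2 (by positivity)
  refine Eq.subst (motive := Matrix.PosSemidef) ?_ (h.smul hc)
  ext x y
  simp [pbtSigma, Matrix.one_apply, funext_iff]

theorem posSemidef_pbtRho (d M : ℕ) : (pbtRho d M).PosSemidef :=
  Matrix.posSemidef_sum _ fun i _ => posSemidef_pbtSigma d M i

theorem isHermitian_pbtRhoInvSqrt (d M : ℕ) : (pbtRhoInvSqrt d M).IsHermitian :=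
  cfc_predicate (p := IsSelfAdjoint) _ _

/-- The matrix is the projection on the kernel of ρ. In functional calculus it is g(ρ) with g = 0 on
positive reals and g = 1 elsewhere, where the conventions √x = 0 for x ≤ 0 and 0⁻¹ = 0 are used. A
self-adjoint idempotent equals its own g(ρ)†g(ρ). -/
theorem posSemidef_one_sub_pbtRhoInvSqrt_mul (d M : ℕ) :
    (1 - pbtRhoInvSqrt d M * pbtRho d M * pbtRhoInvSqrt d M).PosSemidef := by
  have hsa : IsSelfAdjoint (pbtRho d M) := (posSemidef_pbtRho d M).isHermitian
  have hcont : ∀ f : ℝ → ℝ, ContinuousOn f (spectrum ℝ (pbtRho d M)) := fun f =>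
    (Matrix.finite_real_spectrum (A := pbtRho d M)).continuousOn f
  let g : ℝ → ℝ := fun x => 1 - (√x)⁻¹ * x * (√x)⁻¹
  have hg : 1 - pbtRhoInvSqrt d M * pbtRho d M * pbtRhoInvSqrt d M = cfc g (pbtRho d M) := by
    rw [cfc_sub (fun _ => 1) (fun x => (√x)⁻¹ * x * (√x)⁻¹) _ (hcont _) (hcont _),
      cfc_const_one ℝ _,
      cfc_mul (fun x => (√x)⁻¹ * x) (fun x => (√x)⁻¹) _ (hcont _) (hcont _),
      cfc_mul (fun x => (√x)⁻¹) (fun x => x) _ (hcont _) (hcont _), cfc_id' ℝ _]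
    rfl
  have hidem : ∀ x, g x = g x * g x := fun x => by
    rcases le_or_gt x 0 with hx | hx
    · simp [g, Real.sqrt_eq_zero_of_nonpos hx]
    · have h1 : √x ≠ 0 := (Real.sqrt_pos.2 hx).ne'
      have h2 : (√x)⁻¹ * x * (√x)⁻¹ = 1 := by
        nth_rewrite 2 [← Real.mul_self_sqrt hx.le]
        field_simp
      simp [g, h2]
  have hH : (cfc g (pbtRho d M)).IsHermitian := cfc_predicate (p := IsSelfAdjoint) _ _
  have hsq : cfc g (pbtRho d M) =
      (cfc g (pbtRho d M)).conjTranspose * cfc g (pbtRho d M) := by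
    rw [hH.eq, ← cfc_mul g g _ (hcont _) (hcont _)]
    exact congrArg (fun f => cfc f (pbtRho d M)) (funext hidem)
  rw [hg, hsq]
  exact Matrix.posSemidef_conjTranspose_mul_self _

theorem posSemidef_pbtPOVM (d M : ℕ) (i : Fin M) : (pbtPOVM d M i).PosSemidef := by
  have hc : (0 : ℂ) ≤ (M : ℂ)⁻¹ := by
    have : (M : ℂ)⁻¹ = (((M : ℝ))⁻¹ : ℝ) := by push_cast; rfl
    rw [this]
    exact Complex.zero_le_real.2 (by positivity)
  refine Matrix.PosSemidef.add ?_ ((posSemidef_one_sub_pbtRhoInvSqrt_mul d M).smul hc)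
  have h := (posSemidef_pbtSigma d M i).conjTranspose_mul_mul_same (pbtRhoInvSqrt d M)
  rwa [(isHermitian_pbtRhoInvSqrt d M).eq] at h

theorem sum_pbtPOVM (d : ℕ) {M : ℕ} (hM : 0 < M) : ∑ i, pbtPOVM d M i = 1 := by
  have hM' : (M : ℂ) ≠ 0 := Nat.cast_ne_zero.2 hM.ne'
  simp only [pbtPOVM, Finset.sum_add_distrib, ← Finset.sum_mul, ← Finset.mul_sum,
    Finset.sum_const, Finset.card_univ, Fintype.card_fin]
  rw [← pbtRho, ← Nat.cast_smul_eq_nsmul ℂ, smul_smul, mul_inv_cancel₀ hM', one_smul,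
    add_sub_cancel]

/-! ### Teleportation through an arbitrary resource -/

section Simulation

variable {β : Type*}

/-- Insert the value `k` at position `i`. -/
def insertPort {M : ℕ} (i : Fin M) (k : β) (b : {j // j ≠ i} → β) : Fin M → β :=
  (Equiv.funSplitAt i β).symm (k, b)

@[simp] theorem insertPort_self {M : ℕ} (i : Fin M) (k : β) (b : {j // j ≠ i} → β) :
    insertPort i k b i = k := by simp [insertPort]

@[simp] theorem insertPort_ne {M : ℕ} (i : Fin M) (k : β) (b : {j // j ≠ i} → β)
    (j : {j // j ≠ i}) : insertPort i k b j = b j := by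
  simp [insertPort, j.2]

theorem update_insertPort {M : ℕ} (i : Fin M) (k l : β) (b : {j // j ≠ i} → β) :
    Function.update (insertPort i k b) i l = insertPort i l b := by
  ext j
  by_cases hj : j = i
  · subst hj; simp
  · rw [Function.update_of_ne hj]
    exact (insertPort_ne i k b ⟨j, hj⟩).trans (insertPort_ne i l b ⟨j, hj⟩).symm

theorem sum_insertPort [Fintype β] {M : ℕ} (i : Fin M) (f : (Fin M → β) → ℂ) :
    ∑ k, ∑ b, f (insertPort i k b) = ∑ b, f b := by
  rw [← Equiv.sum_comp (Equiv.funSplitAt i β).symm, Fintype.sum_prod_type]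
  rfl

variable [Fintype β]

/-- Outcome `i` of port-based teleportation when the resource state is shared between the `M`
systems `A_j` (`Fin d`) and the `M` ports `B_j` (`β`): measure `Πⁱ` and keep port `i`. -/
def pbtBranch (d : ℕ) {M : ℕ} (i : Fin M) :
    Matrix (Fin d × (Fin M → Fin d × β)) (Fin d × (Fin M → Fin d × β)) ℂ →ₗ[ℂ]
      Matrix β β ℂ where
  toFun Y := Matrix.of fun k l => ∑ b : {j // j ≠ i} → β, ∑ s, ∑ t,
    pbtPOVM d M i t s * Y (s.1, fun j => (s.2 j, insertPort i k b j))
      (t.1, fun j => (t.2 j, insertPort i l b j))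
  map_add' X Y := by
    ext k l
    simp only [Matrix.of_apply, Matrix.add_apply, mul_add, Finset.sum_add_distrib]
  map_smul' c X := by
    ext k l
    simp only [Matrix.of_apply, Matrix.smul_apply, RingHom.id_apply, smul_eq_mul,
      Finset.mul_sum, mul_left_comm c]

theorem isCP_pbtBranch (d : ℕ) {M : ℕ} (i : Fin M) : IsCP (pbtBranch (β := β) d i) := by
  intro r Y hY
  -- For fixed values b of the discarded ports, ∑ Π(t, s) Y(s, t) is a sum of blocks of the Hadamard
  -- product of Πᵀ with Y, which is positive by the Schur product theorem.
  have h := Matrix.posSemidef_sum Finset.univ fun (b : {j // j ≠ i} → β) _ =>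
    posSemidef_sum_blocks (γ := Fin d × (Fin M → Fin d)) (α := Fin r × β)
      (((posSemidef_pbtPOVM d M i).transpose.submatrix
          fun x : (Fin d × (Fin M → Fin d)) × Fin r × β => x.1).hadamard
        (hY.submatrix fun x : (Fin d × (Fin M → Fin d)) × Fin r × β =>
          (x.2.1, (x.1.1, fun j => (x.1.2 j, insertPort i x.2.2 b j)))))
  refine Eq.subst (motive := Matrix.PosSemidef) ?_ h
  ext x y
  simp [idTensor, pbtBranch, Matrix.sum_apply]

theorem trace_pbtBranch (d : ℕ) {M : ℕ} (i : Fin M)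
    (Y : Matrix (Fin d × (Fin M → Fin d × β)) (Fin d × (Fin M → Fin d × β)) ℂ) :
    (pbtBranch d i Y).trace = ∑ b : Fin M → β, ∑ s, ∑ t, pbtPOVM d M i t s *
      Y (s.1, fun j => (s.2 j, b j)) (t.1, fun j => (t.2 j, b j)) :=
  sum_insertPort i fun b => ∑ s, ∑ t, pbtPOVM d M i t s *
      Y (s.1, fun j => (s.2 j, b j)) (t.1, fun j => (t.2 j, b j))

/-- Port-based teleportation with an arbitrary resource state. -/
def pbtSim (d M : ℕ) (β : Type*) [Fintype β] :
    Matrix (Fin d × (Fin M → Fin d × β)) (Fin d × (Fin M → Fin d × β)) ℂ →ₗ[ℂ]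
      Matrix β β ℂ :=
  ∑ i, pbtBranch d i

/-- Positivity holds branch by branch; trace preservation is the completeness relation ∑ Πⁱ = 𝟙,
which fails without ports. -/
theorem isChannel_pbtSim (d : ℕ) {M : ℕ} (hM : 0 < M) : IsChannel (pbtSim d M β) := by
  refine ⟨IsCP.sum fun i _ => isCP_pbtBranch d i, fun Y => ?_⟩
  have hentry : ∀ s t, ∑ i, pbtPOVM d M i t s = if t = s then 1 else 0 := fun s t => by
    rw [← Matrix.sum_apply, sum_pbtPOVM d hM, Matrix.one_apply]
  rw [pbtSim, LinearMap.sum_apply, Matrix.trace_sum]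
  simp only [trace_pbtBranch]
  rw [Finset.sum_comm]
  calc ∑ b : Fin M → β, ∑ i, ∑ s, ∑ t, pbtPOVM d M i t s *
        Y (s.1, fun j => (s.2 j, b j)) (t.1, fun j => (t.2 j, b j))
      = ∑ b : Fin M → β, ∑ s : Fin d × (Fin M → Fin d),
          Y (s.1, fun j => (s.2 j, b j)) (s.1, fun j => (s.2 j, b j)) := by
        refine Finset.sum_congr rfl fun b _ => ?_
        rw [Finset.sum_comm]
        refine Finset.sum_congr rfl fun s _ => ?_
        rw [Finset.sum_comm]
        simp only [← Finset.sum_mul, hentry]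
        simp
    _ = Y.trace := by
        simp only [Matrix.trace, Matrix.diag, Fintype.sum_prod_type]
        rw [Finset.sum_comm]
        refine Finset.sum_congr rfl fun c _ => ?_
        rw [← Equiv.sum_comp (Equiv.arrowProdEquivProdArrow (Fin M) (fun _ => Fin d)
          fun _ => β).symm, Fintype.sum_prod_type, Finset.sum_comm]
        rfl

/-- Teleporting `ρ` through `M` copies of `χ`, with the unused ports traced out of each outcome. -/
theorem pbtSim_attach_tensorPow_apply {d M : ℕ} (ρ : Matrix (Fin d) (Fin d) ℂ)
    (χ : Matrix (Fin d × β) (Fin d × β) ℂ) (k l : β) :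
    pbtSim d M β (attach (tensorPow χ M) ρ) k l = ∑ i, ∑ s, ∑ t, pbtPOVM d M i t s *
      (ρ s.1 t.1 * ∏ j : {j // j ≠ i}, ∑ b, χ (s.2 j, b) (t.2 j, b)) *
        χ (s.2 i, k) (t.2 i, l) := by
  rw [pbtSim, LinearMap.sum_apply, Matrix.sum_apply]
  refine Finset.sum_congr rfl fun i _ => ?_
  simp only [pbtBranch, LinearMap.coe_mk, AddHom.coe_mk, Matrix.of_apply]
  rw [Finset.sum_comm]
  refine Finset.sum_congr rfl fun s _ => ?_
  rw [Finset.sum_comm]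
  refine Finset.sum_congr rfl fun t _ => ?_
  simp only [Fintype.prod_sum, attach, LinearMap.coe_mk, AddHom.coe_mk,
    Matrix.kroneckerMap_apply, tensorPow, Matrix.of_apply]
  rw [Finset.mul_sum, Finset.mul_sum, Finset.sum_mul]
  refine Finset.sum_congr rfl fun b _ => ?_
  rw [Fintype.prod_eq_mul_prod_subtype_ne _ i]
  simp only [insertPort_self, insertPort_ne]
  ring

theorem pbtChannel_eq_pbtSim {d M : ℕ} (ρ : Matrix (Fin d) (Fin d) ℂ) :
    pbtChannel d M ρ = pbtSim d M (Fin d) (attach (tensorPow (maxEnt d) M) ρ) := by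
  have hentry : ∀ (i : Fin M) (s : Fin d × (Fin M → Fin d)) (b b' : Fin M → Fin d),
      ((pbtPOVM d M i ⊗ₖ (1 : Matrix (Fin M → Fin d) (Fin M → Fin d) ℂ)) * pbtJoint d M ρ)
        (s, b) (s, b') = ∑ t, pbtPOVM d M i s t * attach (tensorPow (maxEnt d) M) ρ
          (t.1, fun j => (t.2 j, b j)) (s.1, fun j => (s.2 j, b' j)) := fun i s b b' => by
    rw [Matrix.mul_apply, Fintype.sum_prod_type]
    refine Finset.sum_congr rfl fun t _ => ?_
    rw [Finset.sum_eq_single b]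
    · rw [Matrix.kroneckerMap_apply, Matrix.one_apply_eq, mul_one]
      rfl
    · intro c _ hc
      rw [Matrix.kroneckerMap_apply, Matrix.one_apply_ne (Ne.symm hc), mul_zero, zero_mul]
    · simp
  rw [pbtSim, LinearMap.sum_apply]
  change ∑ i, keepPort i ((pbtPOVM d M i ⊗ₖ 1) * pbtJoint d M ρ) = _
  refine Finset.sum_congr rfl fun i _ => ?_
  ext k l
  simp only [keepPort, pbtBranch, LinearMap.coe_mk, AddHom.coe_mk, Matrix.of_apply, hentry]
  rw [Finset.sum_comm, ← sum_insertPort i]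
  simp only [insertPort_self, update_insertPort]
  rw [Fintype.sum_eq_single k fun k' hk => by simp [hk]]
  simp only [if_true]
  refine Finset.sum_congr rfl fun b _ => ?_
  rw [Finset.sum_comm]

/-- Γ_M(ρ) is a linear combination of blocks of |Φ⟩⟨Φ| at the kept port, and `E` sends each block to
the corresponding block of its Choi matrix. The coefficients involve the resource only through
partial traces over discarded ports, which a trace-preserving `E` leaves unchanged. -/
theorem pbtSim_choi {d M : ℕ} {E : Matrix (Fin d) (Fin d) ℂ →ₗ[ℂ] Matrix β β ℂ}
    (hE : ∀ X, (E X).trace = X.trace) (ρ : Matrix (Fin d) (Fin d) ℂ) :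
    pbtSim d M β (attach (tensorPow (choi E) M) ρ) = E (pbtChannel d M ρ) := by
  have hblock : ∀ x y, ∑ b, choi E (x, b) (y, b) = ∑ c, maxEnt d (x, c) (y, c) := fun x y =>
    hE ((maxEnt d).submatrix (fun c => (x, c)) fun c => (y, c))
  have hΓ : pbtChannel d M ρ = ∑ i, ∑ s, ∑ t, (pbtPOVM d M i t s *
      (ρ s.1 t.1 * ∏ j : {j // j ≠ i}, ∑ b, maxEnt d (s.2 j, b) (t.2 j, b))) •
        (maxEnt d).submatrix (fun c => (s.2 i, c)) fun c => (t.2 i, c) := by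
    rw [pbtChannel_eq_pbtSim]
    ext k l
    rw [pbtSim_attach_tensorPow_apply]
    simp [Matrix.sum_apply]
  rw [hΓ]
  ext k l
  rw [pbtSim_attach_tensorPow_apply]
  simp only [map_sum, map_smul, Matrix.sum_apply, Matrix.smul_apply, hblock, smul_eq_mul]
  rfl

end Simulation

/-! ### The teleportation channel -/

theorem trace_tensorPow {α : Type*} [Fintype α] (X : Matrix α α ℂ) (N : ℕ) :
    (tensorPow X N).trace = X.trace ^ N := by
  have h := Fintype.prod_sum fun (_ : Fin N) a => X a a
  simp only [Finset.prod_const, Finset.card_univ, Fintype.card_fin] at h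
  exact h.symm

theorem isHermitian_tensorPow {α : Type*} {X : Matrix α α ℂ} (hX : X.IsHermitian) (N : ℕ) :
    (tensorPow X N).IsHermitian := by
  ext f g
  simp only [Matrix.conjTranspose_apply, tensorPow, Matrix.of_apply, star_prod]
  exact Finset.prod_congr rfl fun i _ => hX.apply _ _

theorem isState_tensorPow_maxEnt {d : ℕ} (hd : 0 < d) (M : ℕ) :
    IsState (tensorPow (maxEnt d) M) := by
  refine ⟨?_, by rw [trace_tensorPow, trace_maxEnt hd, one_pow]⟩
  refine Eq.subst (motive := Matrix.PosSemidef) ?_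
    (Matrix.posSemidef_vecMulVec_self_star fun f : Fin M → Fin d × Fin d => ∏ i, maxEntVec d (f i))
  ext f g
  simp [tensorPow, maxEnt, Matrix.vecMulVec_apply, Finset.prod_mul_distrib]

theorem isState_choi {d : ℕ} {β : Type*} [Fintype β] (hd : 0 < d)
    {E : Matrix (Fin d) (Fin d) ℂ →ₗ[ℂ] Matrix β β ℂ} (hE : IsChannel E) : IsState (choi E) :=
  hE.idTensorMap.map_isState ⟨posSemidef_maxEnt d, trace_maxEnt hd⟩

theorem isChannel_pbtChannel {d M : ℕ} (hd : 0 < d) (hM : 0 < M) :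
    IsChannel (pbtChannel d M) := by
  have h : pbtChannel d M = pbtSim d M (Fin d) ∘ₗ attach (tensorPow (maxEnt d) M) :=
    LinearMap.ext fun ρ => pbtChannel_eq_pbtSim ρ
  rw [h]
  exact (isChannel_pbtSim d hM).comp (isChannel_attach (isState_tensorPow_maxEnt hd M))

theorem traceNorm_le_diamondDist {α β : Type*} [Fintype α] [Fintype β] [DecidableEq β]
    {E F : Matrix α α ℂ →ₗ[ℂ] Matrix β β ℂ} (hE : IsChannel E) (hF : IsChannel F) {r : ℕ}
    {ρ : Matrix (Fin r × α) (Fin r × α) ℂ} (hρ : IsState ρ) :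
    traceNorm (idTensor E ρ - idTensor F ρ) ≤ diamondDist E F := by
  refine le_csSup ⟨2, ?_⟩ ⟨r, ρ, hρ, rfl⟩
  rintro x ⟨s, τ, hτ, rfl⟩
  exact traceNorm_sub_le (hE.idTensorMap.map_isState hτ) (hF.idTensorMap.map_isState hτ)

theorem IsEffect.abs_re_sub_le {α : Type*} [Fintype α] [DecidableEq α]
    {φ : Matrix α α ℂ →ₗ[ℂ] ℂ} (hφ : IsEffect φ) {X Y : Matrix α α ℂ} (hX : X.IsHermitian)
    (hY : Y.IsHermitian) (htr : X.trace = Y.trace) :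
    |(φ X).re - (φ Y).re| ≤ traceDist X Y := by
  rw [← Complex.sub_re, ← map_sub]
  exact hφ.abs_re_le (hX.sub hY) (by rw [Matrix.trace_sub, htr, sub_self])

/-! ### Adaptive protocols -/

namespace AdaptiveProtocol

variable {d e n : ℕ} (P : AdaptiveProtocol d e n)

theorem state_zero (E : Matrix (Fin d) (Fin d) ℂ →ₗ[ℂ] Matrix (Fin e) (Fin e) ℂ) :
    P.state E 0 = P.init := rfl

theorem state_succ (E : Matrix (Fin d) (Fin d) ℂ →ₗ[ℂ] Matrix (Fin e) (Fin e) ℂ) (k : Fin n) :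
    P.state E k.succ =
      P.op k (idTensorMap _ E (relabel (P.pick k).symm (P.state E k.castSucc))) :=
  Fin.induction_succ (motive := fun k => Matrix (Fin (P.regDim k)) (Fin (P.regDim k)) ℂ) P.init
    (fun k ρ => P.op k (idTensor E (ρ.submatrix (P.pick k).symm (P.pick k).symm))) k

variable {E : Matrix (Fin d) (Fin d) ℂ →ₗ[ℂ] Matrix (Fin e) (Fin e) ℂ}

theorem isState_state (hE : IsChannel E) (k : Fin (n + 1)) : IsState (P.state E k) := by
  induction k using Fin.induction with
  | zero => exact P.init_isState
  | succ k ih =>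
    rw [state_succ]
    exact (P.op_isChannel k).map_isState
      (hE.idTensorMap.map_isState ((isChannel_relabel _).map_isState ih))

/-- Replacing each use of `E` by `E ∘ Γ` changes the outcome probabilities after `k` uses by at
most `k ‖I - Γ‖_⋄ / 2`. -/
theorem abs_re_state_sub_le (hE : IsChannel E)
    {Γ : Matrix (Fin d) (Fin d) ℂ →ₗ[ℂ] Matrix (Fin d) (Fin d) ℂ} (hΓ : IsChannel Γ)
    (k : Fin (n + 1)) {φ : Matrix (Fin (P.regDim k)) (Fin (P.regDim k)) ℂ →ₗ[ℂ] ℂ}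
    (hφ : IsEffect φ) :
    |(φ (P.state E k)).re - (φ (P.state (E ∘ₗ Γ) k)).re| ≤
      (k : ℕ) * (diamondDist LinearMap.id Γ / 2) := by
  induction k using Fin.induction with
  | zero => simp [state_zero]
  | succ k ih =>
    -- Pulling φ back through the last round leaves two errors: the one accumulated in earlier
    -- rounds, bounded by induction for the effect ψ, and the single insertion of Γ before the last
    -- use, worth at most half the diamond distance.
    let ψ := (φ ∘ₗ P.op k) ∘ₗ idTensorMap (Fin (P.restDim k)) E
    have hψ : IsEffect ψ := (hφ.comp (P.op_isChannel k)).comp hE.idTensorMap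
    have h1 := ih (hψ.comp (isChannel_relabel (P.pick k).symm))
    have hs := (isChannel_relabel (P.pick k).symm).map_isState
      (P.isState_state (hE.comp hΓ) k.castSucc)
    set σ := relabel (P.pick k).symm (P.state (E ∘ₗ Γ) k.castSucc) with hσ
    have hs' : IsState (idTensorMap (Fin (P.restDim k)) Γ σ) := hΓ.idTensorMap.map_isState hs
    have h2 := hψ.abs_re_sub_le hs.1.isHermitian hs'.1.isHermitian (hs.2.trans hs'.2.symm)
    have h3 := traceNorm_le_diamondDist (isChannel_id (α := Fin d)) hΓ hs
    have h4 : traceDist σ (idTensorMap (Fin (P.restDim k)) Γ σ) ≤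
        diamondDist LinearMap.id Γ / 2 := by
      unfold traceDist
      exact div_le_div_of_nonneg_right h3 zero_le_two
    have e1 : φ (P.state E k.succ) =
        (ψ ∘ₗ relabel (P.pick k).symm) (P.state E k.castSucc) := by rw [state_succ]; rfl
    have e2 : φ (P.state (E ∘ₗ Γ) k.succ) = ψ (idTensorMap (Fin (P.restDim k)) Γ σ) := by
      rw [state_succ]; rfl
    have e3 : (ψ ∘ₗ relabel (P.pick k).symm) (P.state (E ∘ₗ Γ) k.castSucc) = ψ σ := rfl
    rw [e3] at h1
    rw [e1, e2]
    have h5 := abs_sub_le ((ψ ∘ₗ relabel (P.pick k).symm) (P.state E k.castSucc)).re (ψ σ).re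
      (ψ (idTensorMap (Fin (P.restDim k)) Γ σ)).re
    simp only [Fin.val_castSucc] at h1
    rw [Fin.val_succ, Nat.cast_add_one, add_one_mul]
    linarith

/-- Teleportation stretching: a protocol using `E ∘ Γ_M` in each of `k` rounds is the
action of a fixed channel on `k * M` copies of the Choi state of `E`. -/
theorem exists_simulation {M : ℕ} (hM : 0 < M) (k : Fin (n + 1)) :
    ∃ L : Matrix (Fin (k : ℕ) → Fin M → Fin d × Fin e) (Fin (k : ℕ) → Fin M → Fin d × Fin e) ℂ
        →ₗ[ℂ] Matrix (Fin (P.regDim k)) (Fin (P.regDim k)) ℂ,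
      IsChannel L ∧ ∀ E : Matrix (Fin d) (Fin d) ℂ →ₗ[ℂ] Matrix (Fin e) (Fin e) ℂ, IsChannel E →
        P.state (E ∘ₗ pbtChannel d M) k = L (tensorPow (tensorPow (choi E) M) (k : ℕ)) := by
  induction k using Fin.induction with
  | zero =>
    -- With no use, the resource is the scalar 1 on a one-dimensional system: discard it and prepare
    -- the initial state.
    refine ⟨(Matrix.traceLinearMap _ ℂ ℂ).smulRight P.init, isChannel_trace_smul P.init_isState,
      fun E _ => ?_⟩
    have h : (tensorPow (tensorPow (choi E) M) 0).trace = 1 := by rw [trace_tensorPow, pow_zero]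
    rw [state_zero]
    exact ((congrArg (· • P.init) h).trans (one_smul ℂ _)).symm
  | succ k ih =>
    obtain ⟨L, hL, hsim⟩ := ih
    let R := Fin M → Fin d × Fin e
    let cons : R × (Fin (k : ℕ) → R) ≃ (Fin ((k : ℕ) + 1) → R) := Fin.consEquiv fun _ => R
    let split : Fin (P.restDim k) × (Fin d × R) ≃ R × Fin (P.regDim k.castSucc) :=
      ((Equiv.prodAssoc _ _ _).symm.trans (Equiv.prodComm _ _)).trans
        ((Equiv.refl R).prodCongr (P.pick k).symm)
    -- Set aside one block χ of M Choi states, produce the earlier state from the other blocks by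
    -- `L`, bring the picked system next to χ and teleport it through χ. Nothing here depends on
    -- `E`.
    refine ⟨P.op k ∘ₗ idTensorMap (Fin (P.restDim k)) (pbtSim d M (Fin e)) ∘ₗ relabel split ∘ₗ
      idTensorMap R L ∘ₗ relabel cons,
      (P.op_isChannel k).comp ((isChannel_pbtSim d hM).idTensorMap.comp
        ((isChannel_relabel _).comp (hL.idTensorMap.comp (isChannel_relabel _)))),
      fun E hE => ?_⟩
    rw [state_succ, hsim E hE]
    refine congrArg (P.op k) ?_
    set χ := tensorPow (choi E) M with hχ
    have h1 : relabel cons (tensorPow χ ((k : ℕ) + 1)) = χ ⊗ₖ tensorPow χ (k : ℕ) := by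
      ext x y
      simp [relabel, tensorPow, Fin.prod_univ_succ, cons, Fin.consEquiv]
    have h2 : idTensorMap R L (χ ⊗ₖ tensorPow χ (k : ℕ)) = χ ⊗ₖ L (tensorPow χ (k : ℕ)) := by
      ext x y
      have h : (χ ⊗ₖ tensorPow χ (k : ℕ)).submatrix (fun i => (x.1, i)) (fun j => (y.1, j)) =
        χ x.1 y.1 • tensorPow χ (k : ℕ) := rfl
      exact congrFun (congrFun ((congrArg L h).trans (map_smul L _ _)) x.2) y.2
    have h3 : ∀ X, idTensorMap (Fin (P.restDim k)) (pbtSim d M (Fin e))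
        (relabel split (χ ⊗ₖ X)) = idTensorMap (Fin (P.restDim k)) (E ∘ₗ pbtChannel d M)
          (relabel (P.pick k).symm X) := fun X => by
      ext x y
      have h := congrFun (congrFun (pbtSim_choi (M := M) hE.2 ((relabel (P.pick k).symm X).submatrix
        (fun i => (x.1, i)) (fun j => (y.1, j)))) x.2) y.2
      refine Eq.trans ?_ h
      refine congrArg (fun Z => pbtSim d M (Fin e) Z x.2 y.2) ?_
      ext a b
      exact mul_comm _ _
    change _ = idTensorMap _ _ (relabel split (idTensorMap R L (relabel cons
      (tensorPow χ ((k : ℕ) + 1)))))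
    rw [h1, h2, h3]
    rfl

/-- The protocol that always returns the state `|0⟩⟨0|`. -/
theorem nonempty (hd : 0 < d) : Nonempty (AdaptiveProtocol d e n) := by
  have : NeZero d := ⟨hd.ne'⟩
  let τ : Matrix (Fin d) (Fin d) ℂ := Matrix.single 0 0 1
  have hτ : IsState τ := by
    refine ⟨?_, by simp [τ]⟩
    refine Eq.subst (motive := Matrix.PosSemidef) ?_
      (Matrix.posSemidef_vecMulVec_self_star (Pi.single 0 1 : Fin d → ℂ))
    ext i j
    simp [τ, Matrix.vecMulVec_apply, Matrix.single_apply, Pi.single_apply]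
    grind
  exact ⟨{
    regDim := fun _ => d
    restDim := fun _ => 1
    init := τ
    init_isState := hτ
    pick := fun _ => (Equiv.uniqueProd (Fin d) (Fin 1)).symm
    op := fun _ => (Matrix.traceLinearMap _ ℂ ℂ).smulRight τ
    op_isChannel := fun _ => isChannel_trace_smul hτ }⟩

end AdaptiveProtocol

/-! ### Two-outcome measurements as effects -/

instance {α : Type*} [Fintype α] [DecidableEq α] : Nonempty (BinaryPOVM α) :=
  ⟨{ elt := ![1, 0]
     posSemidef := by
      intro u
      fin_cases u
      · exact Matrix.PosSemidef.one
      · exact Matrix.PosSemidef.zero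
     sum_eq_one := by simp }⟩

theorem BinaryPOVM.isEffect {α : Type*} [Fintype α] [DecidableEq α] (Q : BinaryPOVM α)
    (u : Fin 2) : IsEffect (Matrix.traceLinearMap α ℂ ℂ ∘ₗ LinearMap.mulLeft ℂ (Q.elt u)) := by
  have hs := Q.sum_eq_one
  rw [Fin.sum_univ_two] at hs
  have h : ∀ v, (1 - Q.elt v).PosSemidef := by
    intro v
    fin_cases v
    · change (1 - Q.elt 0).PosSemidef
      rw [← hs, add_sub_cancel_left]; exact Q.posSemidef 1
    · change (1 - Q.elt 1).PosSemidef
      rw [← hs, add_sub_cancel_right]; exact Q.posSemidef 0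
  refine fun X hX => ⟨trace_mul_nonneg (Q.posSemidef u) hX, ?_⟩
  have h2 := trace_mul_nonneg (h u) hX
  rw [sub_mul, one_mul, Matrix.trace_sub] at h2
  exact sub_nonneg.1 h2

end QCD

end

/-! ### The lower bound on the error probability -/

theorem theorem3 (d e : ℕ) (hd : 0 < d)
    (E : Fin 2 → (Matrix (Fin d) (Fin d) ℂ →ₗ[ℂ] Matrix (Fin e) (Fin e) ℂ))
    (hE : ∀ u, QCD.IsChannel (E u)) (n M : ℕ) (hM : 0 < M) :
    (1 - (n : ℝ) * QCD.simError d M -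
        QCD.traceDist (QCD.tensorPow (QCD.choi (E 0)) (n * M))
          (QCD.tensorPow (QCD.choi (E 1)) (n * M))) / 2 ≤
      QCD.minErrorProb E n := by
  -- A real infimum over an empty type would be 0 by convention, so a protocol must exist before it
  -- can be bounded below termwise.
  have := QCD.AdaptiveProtocol.nonempty (d := d) (e := e) (n := n) hd
  refine le_ciInf fun P => le_ciInf fun Q => ?_
  have hΓ := QCD.isChannel_pbtChannel hd hM
  have hφ := Q.isEffect 0
  have h0 := P.abs_re_state_sub_le (hE 0) hΓ (Fin.last n) hφ
  have h1 := P.abs_re_state_sub_le (hE 1) hΓ (Fin.last n) hφ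
  obtain ⟨L, hL, hsim⟩ := P.exists_simulation hM (Fin.last n)
  -- The simulation uses n blocks of M copies; `ι` flattens them into nM copies.
  let ι : (Fin n → Fin M → Fin d × Fin e) ≃ (Fin (n * M) → Fin d × Fin e) :=
    (Equiv.curry _ _ _).symm.trans (finProdFinEquiv.arrowCongr (Equiv.refl _))
  have hι : ∀ X : Matrix (Fin d × Fin e) (Fin d × Fin e) ℂ,
      QCD.relabel ι (QCD.tensorPow X (n * M)) = QCD.tensorPow (QCD.tensorPow X M) n := by
    intro X
    ext f g
    change ∏ i, X (ι f i) (ι g i) = ∏ i, ∏ j, X (f i j) (g i j)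
    rw [← finProdFinEquiv.prod_comp, Fintype.prod_prod_type]
    simp [ι, Equiv.arrowCongr]
  have hc := fun u => QCD.isState_choi hd (hE u)
  -- The same effect on the nM copies serves both hypotheses, because `L` is independent of the
  -- channel. Hermiticity and equal traces of the resources suffice, so positivity of their tensor
  -- powers is not needed.
  have h2 := (hφ.comp (hL.comp (QCD.isChannel_relabel ι))).abs_re_sub_le
    (QCD.isHermitian_tensorPow (hc 0).1.isHermitian (n * M))
    (QCD.isHermitian_tensorPow (hc 1).1.isHermitian (n * M))
    (by rw [QCD.trace_tensorPow, QCD.trace_tensorPow, (hc 0).2, (hc 1).2])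
  simp only [LinearMap.comp_apply, hι] at h2
  have e0 := hsim (E 0) (hE 0)
  have e1 := hsim (E 1) (hE 1)
  simp only [Fin.val_last] at e0 e1 h0 h1
  rw [e0] at h0
  rw [e1] at h1
  simp only [LinearMap.comp_apply, LinearMap.mulLeft_apply, Matrix.traceLinearMap_apply]
    at h0 h1 h2
  -- Expresses the error through Q₀ alone, the effect to which all three estimates apply.
  have hQ : (Q.elt 1 * P.output (E 0)).trace.re = 1 - (Q.elt 0 * P.output (E 0)).trace.re := by
    have hs := Q.sum_eq_one
    rw [Fin.sum_univ_two] at hs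
    have ht : (P.output (E 0)).trace = 1 := (P.isState_state (hE 0) (Fin.last n)).2
    rw [eq_sub_of_add_eq' hs, sub_mul, one_mul, Matrix.trace_sub, ht, Complex.sub_re,
      Complex.one_re]
  rw [hQ]
  simp only [QCD.AdaptiveProtocol.output, QCD.simError]
  have h0' := (abs_le.1 h0).2
  have h1' := (abs_le.1 h1).1
  have h2' := (abs_le.1 h2).2
  linarith
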